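/- All graphs are finite and simple. Let $\mathcal P$ be a principal ideal domain. For a graph $G=(V,E)$, let $L(G,X)$ be the $V\times V$ matrix over $\mathcal P[x_v : v\in V]$ with diagonal entries $x_v$, with entry $-1$ at $(u,v)$ if $u$ and $v$ are adjacent, and with all other entries $0$. The algebraic co-rank $\gamma_{\mathcal P}(G)$ is the largest $i\ge 0$ such that the determinants of the $i\times i$ submatrices of $L(G,X)$ generate the unit ideal (for $i=0$ this always holds). A cograph is a graph with no induced path on four vertices. For $\mathbf d\in\mathbb Z^{V}$ let $G^{\mathbf d}$ be the graph obtained from $G$ by duplicating the vertex $v$ $\mathbf d_v$ times if $\mathbf d_v>0$ and replicating it $-\mathbf d_v$ times if $\mathbf d_v<0$; that is, each vertex $v$ is replaced by $|\mathbf d_v|+1$ copies, pairwise adjacent if $\mathbf d_v<0$ and pairwise nonadjacent otherwise, and copies of distinct vertices are adjacent exactly when these vertices are adjacent in $G$. For $\delta\in\{0,1,-1\}^{V}$ let $\mathcal T_\delta(G)=\{G^{\mathbf d} : \mathbf d\in\mathbb Z^{V},\ \operatorname{sign}(\mathbf d_v)=\delta_v \text{ for all } v\in V\}$, and let $\mathcal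 T^*_\delta(G)$ be the class of all graphs isomorphic to an induced subgraph of a graph in $\mathcal T_\delta(G)$. Then for every integer $k\ge 1$ there is a finite set $\mathcal G$ of pairs $(G,\delta)$, with $G$ a graph and $\delta\in\{0,1,-1\}^{V(G)}$, such that a connected graph $C$ is a cograph with $\gamma_{\mathcal P}(C)\le k$ if and only if $$C\in\bigcup_{(G,\delta)\in\mathcal G}\mathcal T^*_\delta(G).$$ Moreover, every graph in this union, connected or not, is a cograph with algebraic co-rank at most $k$. -/

import Mathlib

open scoped SimpleGraph

noncomputable section

open scoped Classical in
/-- The generalized Laplacian matrix `L(G, X)` of a simple graph `G` over `P[X]`: the variable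
`x_u` at the diagonal position `u`, and minus the number of arcs from `u` to `v` at the
position `(u, v)` with `u ≠ v`. -/
def generalizedLaplacian (P : Type*) [CommRing P] {V : Type*} (G : SimpleGraph V) :
    Matrix V V (MvPolynomial V P) :=
  Matrix.of fun u v => if u = v then MvPolynomial.X u else if G.Adj u v then -1 else 0

/-- The `i`-th critical ideal: the ideal of `P[X]` generated by the determinants of the `i × i`
submatrices of the generalized Laplacian matrix (`i` distinct rows, `i` distinct columns; the
order in which these are listed only changes the sign of the determinant). For `i = 0` it is
the unit ideal, for `i > |V|` it is zero. -/
def criticalIdeal (P : Type*) [CommRing P] {V : Type*} (G : SimpleGraph V) (i : ℕ) :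
    Ideal (MvPolynomial V P) :=
  Ideal.span (Set.range fun rc : (Fin i ↪ V) × (Fin i ↪ V) =>
    ((generalizedLaplacian P G).submatrix rc.1 rc.2).det)

/-- The algebraic co-rank: the largest `i` such that the `i`-th critical ideal is trivial, that
is, the unit ideal (see `isGreatest_algebraicCorank`). -/
def algebraicCorank (P : Type*) [CommRing P] {V : Type*} (G : SimpleGraph V) : ℕ :=
  sSup {i : ℕ | criticalIdeal P G i = ⊤}

theorem isGreatest_algebraicCorank (P : Type*) [CommRing P] [Nontrivial P] {V : Type*} [Finite V]
    (G : SimpleGraph V) :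
    IsGreatest {i : ℕ | criticalIdeal P G i = ⊤} (algebraicCorank P G) := by
  have hb : BddAbove {i : ℕ | criticalIdeal P G i = ⊤} := by
    refine ⟨Nat.card V, fun i hi => ?_⟩
    by_contra hlt
    have hE : IsEmpty (Fin i ↪ V) := ⟨fun f => hlt (by
      simpa using Nat.card_le_card_of_injective f f.injective)⟩
    have h0 : criticalIdeal P G i = ⊥ := by
      simp [criticalIdeal, Set.range_eq_empty]
    exact bot_ne_top (h0.symm.trans hi)
  have hn : {i : ℕ | criticalIdeal P G i = ⊤}.Nonempty := by
    have : Nonempty (Fin 0 ↪ V) := ⟨Function.Embedding.ofIsEmpty⟩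
    exact ⟨0, by simp [criticalIdeal, Ideal.span_singleton_one]⟩
  exact ⟨Nat.sSup_mem hn hb, fun i hi => le_csSup hb hi⟩

/-- A cograph is a simple graph without induced path on four vertices. -/
def IsCograph {V : Type*} (G : SimpleGraph V) : Prop :=
  ¬ SimpleGraph.pathGraph 4 ⊴ G

/-- The graph `G^d`, for an integer vector `d`: every vertex `v` is duplicated `d v` times if
`d v > 0` and replicated `-d v` times if `d v < 0`. So `v` gives rise to the `|d v| + 1` vertices
`(v, 0), …, (v, |d v|)`, which are pairwise adjacent if `d v < 0` and pairwise nonadjacent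
otherwise, and copies of different vertices are adjacent exactly when these are adjacent
in `G`. -/
def twinGraph {V : Type*} (G : SimpleGraph V) (d : V → ℤ) :
    SimpleGraph (Σ v : V, Fin ((d v).natAbs + 1)) where
  Adj a b := G.Adj a.1 b.1 ∨ (a.1 = b.1 ∧ a ≠ b ∧ d a.1 < 0)
  symm := ⟨by
    rintro a b (h | ⟨h, hne, hd⟩)
    · exact Or.inl h.symm
    · exact Or.inr ⟨h.symm, hne.symm, h ▸ hd⟩⟩
  loopless := ⟨by
    rintro a (h | ⟨-, hne, -⟩)
    · exact G.irrefl h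
    · exact hne rfl⟩

/-- `C` belongs to `T*_δ(G)`: it is (isomorphic to) an induced subgraph of a graph of the family
`T_δ(G) = {G^d : supp d = δ}`, where `supp d` is the vector of the signs of the entries of `d`,
and `δ` is a `{0, 1, -1}`-vector. -/
def MemTwinFamilyStar {V W : Type*} (G : SimpleGraph V) (δ : V → SignType)
    (C : SimpleGraph W) : Prop :=
  ∃ d : V → ℤ, (∀ v, SignType.sign (d v) = δ v) ∧ C ⊴ twinGraph G d

end

/-! The co-rank of `G` is at most `k` exactly when `L(G, X)` has rank at most `k` at some point over
a field receiving a map from `P`: a proper critical ideal lies in a maximal ideal, whose residue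
field supplies the point. Off its diagonal the evaluated matrix has only the entries `0` and `-1`,
so rank at most `k` leaves at most `k + 2 ^ k` distinct rows. Vertices with equal rows are twins,
false or true as their diagonal entry is `0` or `-1`. Hence `C` embeds in some `G^d`, with `G`
induced on representatives and the signs of `d` given by the twin types. For every `d` with these
signs, the point extends to `G^d` by repeating rows and columns, so the rank does not grow; and
twins never create an induced path on four vertices. So finitely many pairs `(G, δ)` suffice. -/

/-! ### Rank, minors and distinct rows -/

open Module in
/-- The columns of a matrix over a field are spanned by `A.rank` linearly independent ones. -/
theorem Matrix.exists_linearIndependent_cols {K m n : Type*} [Field K] [Fintype n]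
    (A : Matrix m n K) :
    ∃ c : Fin A.rank → n, LinearIndependent K (fun j => A.col (c j)) ∧
      Submodule.span K (Set.range fun j => A.col (c j)) = Submodule.span K (Set.range A.col) := by
  have : FiniteDimensional K (Submodule.span K (Set.range A.col)) :=
    FiniteDimensional.span_of_finite K (Set.finite_range _)
  obtain ⟨f, hf, hspan, hli⟩ := Submodule.exists_fun_fin_finrank_span_eq K (Set.range A.col)
  generalize hr : finrank K (Submodule.span K (Set.range A.col)) = r at f
  obtain rfl : A.rank = r := A.rank_eq_finrank_span_cols.trans hr
  choose c hc using hf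
  obtain rfl : (fun j => A.col (c j)) = f := funext hc
  exact ⟨c, hli, hspan⟩

/-- Over a field, a matrix of rank at least `i` has a nonzero `i × i` minor. -/
theorem Matrix.exists_det_submatrix_ne_zero {K m n : Type*} [Field K] [Fintype m] [Fintype n]
    (A : Matrix m n K) {i : ℕ} (hi : i ≤ A.rank) :
    ∃ (r : Fin i ↪ m) (c : Fin i ↪ n), (A.submatrix r c).det ≠ 0 := by
  obtain ⟨c₀, hc₀, -⟩ := A.exists_linearIndependent_cols
  set c : Fin i → n := c₀ ∘ Fin.castLE hi
  have hc : LinearIndependent K (A.submatrix id c).col :=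
    hc₀.comp (Fin.castLE hi) (Fin.castLE_injective hi)
  have hrank : (A.submatrix id c).transpose.rank = i := by
    rw [Matrix.rank_transpose, Matrix.rank_eq_finrank_span_cols, finrank_span_eq_card hc,
      Fintype.card_fin]
  obtain ⟨r₀, hr₀, -⟩ := (A.submatrix id c).transpose.exists_linearIndependent_cols
  set r : Fin i → m := r₀ ∘ Fin.cast hrank.symm
  have hr : LinearIndependent K (A.submatrix r c).row :=
    hr₀.comp (Fin.cast hrank.symm) (Fin.cast_injective _)
  have hdet : (A.submatrix r c).det ≠ 0 :=
    ((Matrix.isUnit_iff_isUnit_det _).1 (Matrix.linearIndependent_rows_iff_isUnit.1 hr)).ne_zero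
  refine ⟨⟨r, fun a b hab => ?_⟩, ⟨c, fun a b hab => ?_⟩, hdet⟩
  · by_contra hne
    exact hdet (Matrix.det_zero_of_row_eq hne (by ext j; simp [hab]))
  · by_contra hne
    exact hdet (Matrix.det_zero_of_column_eq hne (by simp [hab]))

/-- A square matrix over a field whose off-diagonal entries take at most two values has boundedly
many distinct rows in terms of its rank. -/
theorem Matrix.ncard_range_row_le {K n : Type*} [Field K] [Fintype n] (A : Matrix n n K)
    (a b : K) (hA : ∀ i j, i ≠ j → A i j = a ∨ A i j = b) :
    (Set.range A.row).ncard ≤ A.rank + 2 ^ A.rank := by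
  classical
  obtain ⟨c, -, hspan⟩ := A.exists_linearIndependent_cols
  -- The difference of the coordinates `u` and `v` vanishes on the chosen columns, hence on the
  -- whole column space.
  have hrow : ∀ u v, (∀ j, A u (c j) = A v (c j)) → A.row u = A.row v := by
    intro u v h
    have hle : Submodule.span K (Set.range A.col) ≤
        LinearMap.ker ((LinearMap.proj u : (n → K) →ₗ[K] K) - LinearMap.proj v) := by
      rw [← hspan, Submodule.span_le]
      rintro _ ⟨j, rfl⟩
      simpa [sub_eq_zero] using h j
    ext j
    simpa [sub_eq_zero] using hle (Submodule.subset_span ⟨j, rfl⟩)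
  -- Rows with index in `Set.range c` may meet the diagonal, where entries are arbitrary; they are
  -- counted one by one. Every other row is determined by a word in `a` and `b`.
  have hsub : Set.range A.row ⊆ A.row '' Set.range c ∪ A.row '' (Set.range c)ᶜ := by
    rw [← Set.image_union, Set.union_compl_self, Set.image_univ]
  have h₁ : (A.row '' Set.range c).ncard ≤ A.rank := by
    refine (Set.ncard_image_le (Set.toFinite _)).trans ?_
    rw [← Set.image_univ]
    refine (Set.ncard_image_le (Set.toFinite _)).trans ?_
    simp [Set.ncard_univ]
  have h₂ : (A.row '' (Set.range c)ᶜ).ncard ≤ 2 ^ A.rank := by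
    let t : Finset (Fin A.rank → K) := Fintype.piFinset fun _ => {a, b}
    have hinj : Set.InjOn (fun (f : n → K) j => f (c j)) (A.row '' (Set.range c)ᶜ) := by
      rintro _ ⟨u, -, rfl⟩ _ ⟨v, -, rfl⟩ h
      exact hrow u v (congrFun h)
    have hmap : ∀ f ∈ A.row '' (Set.range c)ᶜ, (fun j => f (c j)) ∈ (t : Set (Fin A.rank → K)) := by
      rintro _ ⟨u, hu, rfl⟩
      simp only [t, Finset.mem_coe, Fintype.mem_piFinset, Finset.mem_insert, Finset.mem_singleton]
      exact fun j => hA u (c j) fun h => hu ⟨j, h.symm⟩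
    refine (Set.ncard_le_ncard_of_injOn _ hmap hinj t.finite_toSet).trans ?_
    rw [Set.ncard_coe_finset, Fintype.card_piFinset, Finset.prod_const, Finset.card_univ,
      Fintype.card_fin]
    exact Nat.pow_le_pow_left Finset.card_le_two _
  calc (Set.range A.row).ncard ≤ _ := Set.ncard_le_ncard hsub (Set.toFinite _)
    _ ≤ _ := Set.ncard_union_le _ _
    _ ≤ _ := add_le_add h₁ h₂

/-! ### Evaluations of the generalized Laplacian -/

open scoped Classical in
/-- The generalized Laplacian matrix evaluated at the point `x`. -/
noncomputable def laplacianAt {K V : Type*} [CommRing K] (G : SimpleGraph V) (x : V → K) : Matrix V V K :=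
  Matrix.of fun u v => if u = v then x u else if G.Adj u v then -1 else 0

section laplacianAt

variable {K V : Type*} [Field K] (G : SimpleGraph V) (x : V → K)

theorem laplacianAt_self (u : V) : laplacianAt G x u u = x u := by
  simp [laplacianAt]

variable {G} in
theorem laplacianAt_of_adj {u v : V} (h : G.Adj u v) : laplacianAt G x u v = -1 := by
  simp [laplacianAt, h.ne, h]

variable {G} in
theorem laplacianAt_of_not_adj {u v : V} (hne : u ≠ v) (h : ¬ G.Adj u v) :
    laplacianAt G x u v = 0 := by
  simp [laplacianAt, hne, h]

theorem laplacianAt_eq_neg_one_iff {u v : V} (hne : u ≠ v) :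
    laplacianAt G x u v = -1 ↔ G.Adj u v := by
  by_cases h : G.Adj u v <;> simp [laplacianAt, hne, h]

theorem laplacianAt_offDiag {u v : V} (hne : u ≠ v) :
    laplacianAt G x u v = 0 ∨ laplacianAt G x u v = -1 := by
  by_cases h : G.Adj u v <;> simp [laplacianAt, hne, h]

theorem laplacianAt_comm (u v : V) : laplacianAt G x u v = laplacianAt G x v u := by
  by_cases huv : u = v
  · rw [huv]
  · simp only [laplacianAt, Matrix.of_apply, if_neg huv, if_neg (Ne.symm huv)]
    congr 1
    exact propext (G.adj_comm u v)

/-- Distinct vertices with the same row are twins, and the type of the twins can be read off from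
their common diagonal entry. -/
theorem laplacianAt_of_row_eq {u w : V} (h : laplacianAt G x u = laplacianAt G x w) :
    x u = x w ∧ laplacianAt G x u w = x u := by
  have h₁ := congrFun h u
  have h₂ := congrFun h w
  rw [laplacianAt_self] at h₁ h₂
  rw [laplacianAt_comm, ← h₁] at h₂
  exact ⟨h₂, by rw [laplacianAt_comm, ← h₁]⟩

theorem map_generalizedLaplacian {P : Type*} [CommRing P] (φ : MvPolynomial V P →+* K) :
    (generalizedLaplacian P G).map φ = laplacianAt G fun v => φ (MvPolynomial.X v) := by
  ext u v
  simp only [generalizedLaplacian, laplacianAt, Matrix.map_apply,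
    Matrix.of_apply]
  split_ifs <;> simp

end laplacianAt

/-- Evaluation at `x` kills every minor of size above `k`, so a critical ideal of such an index lies
in a kernel, which is proper. -/
theorem algebraicCorank_le_of_rank_le {P K V : Type*} [CommRing P] [Nontrivial P] [Field K]
    [Fintype V] {G : SimpleGraph V} {k : ℕ} (f : P →+* K) (x : V → K)
    (h : (laplacianAt G x).rank ≤ k) : algebraicCorank P G ≤ k := by
  have hmem : criticalIdeal P G (algebraicCorank P G) = ⊤ := (isGreatest_algebraicCorank P G).1
  by_contra! hlt
  set i := algebraicCorank P G
  let φ : MvPolynomial V P →+* K := MvPolynomial.eval₂Hom f x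
  have hφ : (generalizedLaplacian P G).map φ = laplacianAt G x := by
    rw [map_generalizedLaplacian]
    simp [φ]
  have hle : criticalIdeal P G i ≤ RingHom.ker φ := by
    rw [criticalIdeal, Ideal.span_le]
    rintro _ ⟨⟨r, c⟩, rfl⟩
    simp only [SetLike.mem_coe, RingHom.mem_ker, RingHom.map_det]
    have hs : φ.mapMatrix ((generalizedLaplacian P G).submatrix r c) =
        (laplacianAt G x).submatrix r c := by
      rw [← hφ]
      rfl
    rw [hs]
    by_contra hdet
    have h₁ := Matrix.rank_of_isUnit _ ((Matrix.isUnit_iff_isUnit_det _).2 (Ne.isUnit hdet))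
    have h₂ := Matrix.rank_submatrix_le (laplacianAt G x) r c
    rw [Fintype.card_fin] at h₁
    omega
  rw [hmem, top_le_iff] at hle
  exact RingHom.ker_ne_top φ hle

/-- Converse of the previous bound. The ideal `I` is exposed so that the map from `P` to the field
remains available for other graphs; the fraction ring of the quotient carries the field structure.
-/
theorem exists_rank_le_of_algebraicCorank_le {P : Type*} {V : Type*} [CommRing P] [Nontrivial P]
    [Fintype V] {G : SimpleGraph V} {k : ℕ} (h : algebraicCorank P G ≤ k) :
    ∃ (I : Ideal (MvPolynomial V P)) (_ : I.IsMaximal) (x : V → FractionRing (MvPolynomial V P ⧸ I)),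
      (laplacianAt G x).rank ≤ k := by
  have hne : criticalIdeal P G (k + 1) ≠ ⊤ := fun htop => by
    have := (isGreatest_algebraicCorank P G).2 htop
    omega
  obtain ⟨I, hI, hle⟩ := Ideal.exists_le_maximal _ hne
  let ψ := algebraMap (MvPolynomial V P ⧸ I) (FractionRing (MvPolynomial V P ⧸ I))
  let φ := ψ.comp (Ideal.Quotient.mk I)
  refine ⟨I, hI, fun v => φ (MvPolynomial.X v), ?_⟩
  by_contra! hlt
  obtain ⟨r, c, hdet⟩ := Matrix.exists_det_submatrix_ne_zero _ (Nat.succ_le_of_lt hlt)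
  refine hdet ?_
  have hs : φ.mapMatrix ((generalizedLaplacian P G).submatrix r c) =
      (laplacianAt G fun v => φ (MvPolynomial.X v)).submatrix r c := by
    rw [← map_generalizedLaplacian]
    rfl
  rw [← hs, ← RingHom.map_det]
  have hmem : ((generalizedLaplacian P G).submatrix r c).det ∈ I :=
    hle (Ideal.subset_span ⟨(r, c), rfl⟩)
  simp [φ, Ideal.Quotient.eq_zero_iff_mem.2 hmem]

theorem laplacianAt_comp_embedding {K V W : Type*} [Field K] {H : SimpleGraph V}
    {G : SimpleGraph W} (f : H ↪g G) (x : W → K) :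
    laplacianAt H (x ∘ f) = (laplacianAt G x).submatrix f f := by
  ext u v
  simp only [laplacianAt, Matrix.of_apply, Matrix.submatrix_apply, Function.comp_apply]
  congr 1
  · exact propext f.injective.eq_iff.symm
  · congr 1
    exact propext f.map_adj_iff.symm

theorem algebraicCorank_le_of_isIndContained {P V W : Type*} [CommRing P] [Nontrivial P] [Finite V]
    [Finite W] {H : SimpleGraph V} {G : SimpleGraph W} (hHG : H ⊴ G) {k : ℕ}
    (h : algebraicCorank P G ≤ k) : algebraicCorank P H ≤ k := by
  cases nonempty_fintype V
  cases nonempty_fintype W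
  obtain ⟨f⟩ := hHG
  obtain ⟨I, hI, x, hx⟩ := exists_rank_le_of_algebraicCorank_le h
  refine algebraicCorank_le_of_rank_le
    ((algebraMap _ _).comp ((Ideal.Quotient.mk I).comp MvPolynomial.C)) (x ∘ f) ?_
  rw [laplacianAt_comp_embedding]
  exact (Matrix.rank_submatrix_le _ _ _).trans hx

/-! ### Cographs and twins -/

theorem IsCograph.of_isIndContained {V W : Type*} {H : SimpleGraph V} {G : SimpleGraph W}
    (hG : IsCograph G) (hHG : H ⊴ G) : IsCograph H :=
  fun h => hG (h.trans hHG)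

/-- The path on four vertices has no twins. -/
theorem pathGraph_four_exists_adj_ne (i j : Fin 4) (hij : i ≠ j) :
    ∃ l, l ≠ i ∧ l ≠ j ∧
      ¬ ((SimpleGraph.pathGraph 4).Adj i l ↔ (SimpleGraph.pathGraph 4).Adj j l) := by
  simp only [SimpleGraph.pathGraph_adj]
  revert i j
  decide

/-- Two path vertices in one class would be twins in the path, so an induced path projects
injectively to `G`. -/
theorem IsCograph.twinGraph {V : Type*} {G : SimpleGraph V} (hG : IsCograph G) (d : V → ℤ) :
    IsCograph (twinGraph G d) := by
  rintro ⟨f⟩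
  have hinj : Function.Injective fun i => (f i).1 := by
    intro i j hij
    by_contra hne
    obtain ⟨l, hli, hlj, hl⟩ := pathGraph_four_exists_adj_ne i j hne
    refine hl ?_
    rw [← f.map_adj_iff, ← f.map_adj_iff]
    have hi : f i ≠ f l := fun h => hli (f.injective h).symm
    have hj : f j ≠ f l := fun h => hlj (f.injective h).symm
    have hij' : (f i).1 = (f j).1 := hij
    change (G.Adj _ _ ∨ _ ∧ _ ∧ d _ < 0) ↔ (G.Adj _ _ ∨ _ ∧ _ ∧ d _ < 0)
    rw [hij']
    simp [hi, hj]
  refine hG ⟨⟨⟨fun i => (f i).1, hinj⟩, fun {i j} => ?_⟩⟩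
  rw [← f.map_adj_iff]
  constructor
  · exact Or.inl
  · rintro (h | ⟨h, hne, -⟩)
    · exact h
    · exact absurd (congrArg f (hinj h)) hne

/-! ### The quotient by equal rows -/

/-- The data of a quotient of `C` by the relation of having equal rows: `q` maps a vertex to its
class, and `s` picks a representative of every class. -/
structure RowQuotient {K W : Type*} [Field K] (C : SimpleGraph W) (x : W → K) (n : ℕ) where
  q : W → Fin n
  s : Fin n → W
  q_s : ∀ v, q (s v) = v
  q_eq_iff : ∀ u w, q u = q w ↔ laplacianAt C x u = laplacianAt C x w

theorem exists_rowQuotient {K W : Type*} [Field K] [Fintype W] (C : SimpleGraph W) (x : W → K) :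
    ∃ n ≤ (laplacianAt C x).rank + 2 ^ (laplacianAt C x).rank,
      Nonempty (RowQuotient C x n) := by
  have hle := (laplacianAt C x).ncard_range_row_le 0 (-1) fun i j => laplacianAt_offDiag C x
  let e := Finite.equivFin (Set.range (laplacianAt C x).row)
  rw [← Nat.card_coe_set_eq] at hle
  refine ⟨_, hle, ⟨⟨fun w => e ⟨_, Set.mem_range_self w⟩, fun v => (e.symm v).2.choose, fun v => ?_,
    fun u w => ?_⟩⟩⟩
  · rw [← e.eq_symm_apply]
    exact Subtype.ext (e.symm v).2.choose_spec
  · rw [e.injective.eq_iff, Subtype.mk_eq_mk]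
    rfl

namespace RowQuotient

variable {K W : Type*} [Field K] {C : SimpleGraph W} {x : W → K} {n : ℕ} (Q : RowQuotient C x n)

theorem s_injective : Function.Injective Q.s :=
  Function.LeftInverse.injective Q.q_s

/-- The graph induced on the representatives. -/
def graph : SimpleGraph (Fin n) := C.comap Q.s

theorem graph_isIndContained : Q.graph ⊴ C :=
  ⟨SimpleGraph.Embedding.comap ⟨Q.s, Q.s_injective⟩ C⟩

open scoped Classical in
/-- The type of a class: `0` for a singleton, `1` for false twins, `-1` for true twins. -/
noncomputable def twinType (v : Fin n) : SignType :=
  if ∃ u, u ≠ Q.s v ∧ Q.q u = v then if x (Q.s v) = 0 then 1 else -1 else 0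

theorem x_s_q (u : W) : x (Q.s (Q.q u)) = x u :=
  (laplacianAt_of_row_eq C x ((Q.q_eq_iff _ _).1 (Q.q_s (Q.q u)))).1

theorem eq_of_twinType_eq_zero {u w : W} (h : Q.q u = Q.q w) (h0 : Q.twinType (Q.q w) = 0) :
    u = w := by
  have hs : ∀ a, Q.q a = Q.q w → a = Q.s (Q.q w) := by
    intro a ha
    by_contra hne
    have hex : ∃ u, u ≠ Q.s (Q.q w) ∧ Q.q u = Q.q w := ⟨a, hne, ha⟩
    rw [twinType, if_pos hex] at h0
    split_ifs at h0
  exact (hs u h).trans (hs w rfl).symm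

theorem exists_of_twinType_ne_zero {v : Fin n} (h : Q.twinType v ≠ 0) :
    ∃ u, u ≠ Q.s v ∧ Q.q u = v := by
  by_contra hne
  exact h (if_neg hne)

/-- With equal rows, the diagonal entry equals the entry between the two twins, which is `0` or
`-1`. -/
theorem x_eq_of_twinType {v : Fin n} (h : Q.twinType v ≠ 0) :
    x (Q.s v) = if Q.twinType v = -1 then -1 else 0 := by
  have hex := Q.exists_of_twinType_ne_zero h
  obtain ⟨u, hu, huv⟩ := id hex
  have hrow := (Q.q_eq_iff (Q.s v) u).1 (by rw [Q.q_s, huv])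
  have hx := (laplacianAt_of_row_eq C x hrow).2
  have hoff := laplacianAt_offDiag C x hu.symm
  rw [hx] at hoff
  rw [twinType, if_pos hex]
  rcases hoff with h0 | h1
  · rw [if_pos h0, h0, if_neg (by decide)]
  · rw [if_neg fun h0 => neg_ne_zero.2 one_ne_zero (h1.symm.trans h0), h1, if_pos rfl]

theorem adj_iff_of_q_eq {u w : W} (h : Q.q u = Q.q w) (hne : u ≠ w) :
    C.Adj u w ↔ Q.twinType (Q.q u) = -1 := by
  have h0 : Q.twinType (Q.q u) ≠ 0 := fun h0 => hne (Q.eq_of_twinType_eq_zero h (h ▸ h0))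
  rw [← laplacianAt_eq_neg_one_iff C x hne,
    (laplacianAt_of_row_eq C x ((Q.q_eq_iff _ _).1 h)).2, ← Q.x_s_q, Q.x_eq_of_twinType h0]
  split_ifs with h1 <;> simp [h1]

theorem adj_iff_of_q_ne {u w : W} (h : Q.q u ≠ Q.q w) :
    C.Adj u w ↔ Q.graph.Adj (Q.q u) (Q.q w) := by
  have hrow : ∀ a, laplacianAt C x (Q.s (Q.q a)) = laplacianAt C x a := fun a =>
    (Q.q_eq_iff _ _).1 (Q.q_s _)
  change _ ↔ C.Adj (Q.s (Q.q u)) (Q.s (Q.q w))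
  rw [← laplacianAt_eq_neg_one_iff C x fun huw => h (congrArg Q.q huw),
    ← laplacianAt_eq_neg_one_iff C x (Q.s_injective.ne h), hrow u, laplacianAt_comm C x u w,
    laplacianAt_comm C x u, hrow w]

theorem laplacianAt_twinGraph {d : Fin n → ℤ} (hd : ∀ v, SignType.sign (d v) = Q.twinType v) :
    laplacianAt (twinGraph Q.graph d) (fun a => x (Q.s a.1)) =
      (laplacianAt C x).submatrix (fun a => Q.s a.1) fun a => Q.s a.1 := by
  ext a b
  rw [Matrix.submatrix_apply]
  by_cases hab : a = b
  · rw [hab, laplacianAt_self, laplacianAt_self]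
  by_cases hfst : a.1 = b.1
  · rw [← hfst, laplacianAt_self]
    -- A class of type `0` has a single copy, which would force `a = b`.
    have h0 : Q.twinType a.1 ≠ 0 := by
      intro h0
      rw [← hd, sign_eq_zero_iff] at h0
      obtain ⟨v, i⟩ := a
      obtain ⟨w, j⟩ := b
      obtain rfl : v = w := hfst
      have hi := i.2
      have hj := j.2
      simp only at h0
      simp only [h0, Int.natAbs_zero] at hi hj
      exact hab (by congr 1; ext; omega)
    rw [Q.x_eq_of_twinType h0]
    simp only [← hd, sign_eq_neg_one_iff]
    split_ifs with hneg
    · exact laplacianAt_of_adj _ (Or.inr ⟨hfst, hab, hneg⟩)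
    · refine laplacianAt_of_not_adj _ hab ?_
      rintro (h | ⟨-, -, h⟩)
      · exact h.ne hfst
      · exact hneg h
  · have hs : Q.s a.1 ≠ Q.s b.1 := Q.s_injective.ne hfst
    by_cases hadj : C.Adj (Q.s a.1) (Q.s b.1)
    · rw [laplacianAt_of_adj _ hadj]
      exact laplacianAt_of_adj _ (Or.inl hadj)
    · rw [laplacianAt_of_not_adj _ hs hadj]
      refine laplacianAt_of_not_adj _ hab ?_
      rintro (h | ⟨h, -, -⟩)
      · exact hadj h
      · exact hfst h

theorem memTwinFamilyStar [Finite W] : MemTwinFamilyStar Q.graph Q.twinType C := by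
  let N := Nat.card W
  let e := Finite.equivFin W
  -- A class of nonzero type gets `N + 1` copies, so one numbering `e` of all of `W` provides the
  -- indices in every class.
  let d : Fin n → ℤ := fun v => (Q.twinType v : ℤ) * N
  have hN : ∀ v : Fin n, 0 < N := fun v =>
    have : Nonempty W := ⟨Q.s v⟩
    Nat.card_pos
  have hsign : ∀ v, SignType.sign (d v) = Q.twinType v := by
    intro v
    have : SignType.sign (N : ℤ) = 1 := sign_pos (by exact_mod_cast hN v)
    simp only [d, sign_mul, this, mul_one]
    cases Q.twinType v <;> rfl
  let idx : W → ℕ := fun w => if Q.twinType (Q.q w) = 0 then 0 else e w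
  have hidx : ∀ w, idx w < (d (Q.q w)).natAbs + 1 := by
    intro w
    have hw : (e w : ℕ) < N := (e w).2
    simp only [idx, d, Int.natAbs_mul, Int.natAbs_natCast]
    cases hq : Q.twinType (Q.q w)
    · simp
    · simpa using hw.le
    · simpa using hw.le
  let f : W → Σ v : Fin n, Fin ((d v).natAbs + 1) := fun w => ⟨Q.q w, idx w, hidx w⟩
  have hf : Function.Injective f := by
    intro u w huw
    have hq : Q.q u = Q.q w := congrArg Sigma.fst huw
    have hi : idx u = idx w := congrArg (fun a => (a.2 : ℕ)) huw
    by_cases h0 : Q.twinType (Q.q w) = 0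
    · exact Q.eq_of_twinType_eq_zero hq h0
    · simp only [idx, hq, if_neg h0] at hi
      exact e.injective (Fin.ext hi)
  refine ⟨d, hsign, ⟨⟨f, hf⟩, fun {u w} => ?_⟩⟩
  change (Q.graph.Adj (Q.q u) (Q.q w) ∨ (Q.q u = Q.q w ∧ f u ≠ f w ∧ d (Q.q u) < 0)) ↔ _
  by_cases huw : u = w
  · simp [huw]
  by_cases hq : Q.q u = Q.q w
  · rw [Q.adj_iff_of_q_eq hq huw, ← hsign, sign_eq_neg_one_iff]
    simp [hq, hf.ne huw]
  · rw [Q.adj_iff_of_q_ne hq]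
    simp [hq]

end RowQuotient

/-! ### The finite family -/

theorem mainTheorem7 (P : Type*) [CommRing P] [IsDomain P] [IsPrincipalIdealRing P]
    (k : ℕ) (hk : 1 ≤ k) :
    ∃ 𝒢 : Set (Σ n : ℕ, SimpleGraph (Fin n) × (Fin n → SignType)), 𝒢.Finite ∧
      ∀ (W : Type*) [Finite W] (C : SimpleGraph W),
        (C.Connected →
          ((IsCograph C ∧ algebraicCorank P C ≤ k) ↔
            ∃ p ∈ 𝒢, MemTwinFamilyStar p.2.1 p.2.2 C)) ∧
        ((∃ p ∈ 𝒢, MemTwinFamilyStar p.2.1 p.2.2 C) →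
          IsCograph C ∧ algebraicCorank P C ≤ k) := by
  -- Asking that the whole family of a pair qualify leaves only heredity to use for the union; the
  -- size bound gives finiteness.
  let 𝒢 : Set (Σ n : ℕ, SimpleGraph (Fin n) × (Fin n → SignType)) :=
    {p | p.1 ≤ k + 2 ^ k ∧ ∀ d : Fin p.1 → ℤ, (∀ v, SignType.sign (d v) = p.2.2 v) →
      IsCograph (twinGraph p.2.1 d) ∧ algebraicCorank P (twinGraph p.2.1 d) ≤ k}
  have hfin : 𝒢.Finite :=
    (Set.finite_range fun a : Σ n : Fin (k + 2 ^ k + 1),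
      SimpleGraph (Fin n) × (Fin n → SignType) => ⟨a.1, a.2⟩).subset
      fun p hp => ⟨⟨⟨p.1, Nat.lt_succ_of_le hp.1⟩, p.2⟩, rfl⟩
  refine ⟨𝒢, hfin, fun W _ C => ?_⟩
  have hback : (∃ p ∈ 𝒢, MemTwinFamilyStar p.2.1 p.2.2 C) →
      IsCograph C ∧ algebraicCorank P C ≤ k := by
    rintro ⟨p, hp, d, hd, hC⟩
    obtain ⟨h₁, h₂⟩ := hp.2 d hd
    exact ⟨h₁.of_isIndContained hC, algebraicCorank_le_of_isIndContained hC h₂⟩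
  refine ⟨fun _ => ⟨?_, hback⟩, hback⟩
  rintro ⟨hcog, hcorank⟩
  cases nonempty_fintype W
  obtain ⟨I, hI, x, hx⟩ := exists_rank_le_of_algebraicCorank_le hcorank
  obtain ⟨n, hn, ⟨Q⟩⟩ := exists_rowQuotient C x
  refine ⟨⟨n, Q.graph, Q.twinType⟩, ⟨hn.trans ?_, fun d hd => ?_⟩, Q.memTwinFamilyStar⟩
  · exact add_le_add hx (Nat.pow_le_pow_right two_pos hx)
  · refine ⟨(hcog.of_isIndContained Q.graph_isIndContained).twinGraph d, ?_⟩
    refine algebraicCorank_le_of_rank_le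
      ((algebraMap _ _).comp ((Ideal.Quotient.mk I).comp MvPolynomial.C))
      (fun a => x (Q.s a.1)) ?_
    rw [Q.laplacianAt_twinGraph hd]
    exact (Matrix.rank_submatrix_le _ _ _).trans hx
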